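/- All graphs are finite and simple. For a graph $G$ with vertex set $V(G)$ and a field $k$, let $R_k(G)=k[x_a : a\in V(G)]$, let $I(G)$ be the ideal generated by the monomials $x_ax_b$ with $\{a,b\}$ an edge of $G$, and let $\operatorname{pd}^k(G)$ be the projective dimension of the $R_k(G)$-module $R_k(G)/I(G)$. For $W\subseteq V(G)$, $G\setminus W$ denotes the subgraph of $G$ obtained by deleting the vertices in $W$. **Theorem.** Let $T$ be a forest. 1. $\operatorname{pd}^k(T)$ does not depend on the field $k$; write $\operatorname{pd}(T)$ for it. 2. Let $v$ be a vertex of $T$ with exactly $n\ge 1$ neighbours $v_1,\dots,v_n$, labelled so that $v_1,\dots,v_{n-1}$ all have degree $1$ (and, if $n=1$, so that $v_1$ has degree $1$). Put $T'=T\setminus\{v_1\}$ and $T''=T\setminus\{v,v_1,\dots,v_n\}$. Then $$\operatorname{pd}(T)=\max\{\operatorname{pd}(T'),\ \operatorname{pd}(T'')+n\}.$$ 3. Consequently $\operatorname{pd}(T)$ is computed, over every field, by the following recursive algorithm, whose input is a forest given with any listing of its vertices. Search, in the order of the listing, for a pair $(v,v_1)$ of adjacent vertices such that $v_1$ has degree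 $1$ and at most one neighbour of $v$ has degree different from $1$. If there is no such pair, return $0$. Otherwise let $n$ be the degree of $v$, and return $\max\{p',p''+n\}$, where $p'$ and $p''$ are the results of the algorithm for $T\setminus\{v_1\}$ and for the forest obtained from $T$ by deleting $v$ and all its neighbours. -/

import Mathlib

universe u w w'

/-- The graph ideal `I(G)` of `R_k(G) = k[x_a : a a vertex of G]`, generated by the monomials
`x_a x_b` for the edges `{a, b}` of `G`. -/
noncomputable def graphIdeal (k : Type w) [Field k] {V : Type u} (G : SimpleGraph V) :
    Ideal (MvPolynomial V k) :=
  Ideal.span {p | ∃ a b : V, G.Adj a b ∧ p = MvPolynomial.X a * MvPolynomial.X b}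

/-- The projective dimension `pd^k(G)` of a graph: that of the `R_k(G)`-module
`k[Δ(G)] = R_k(G) / I(G)`. -/
noncomputable def graphPd (k : Type w) [Field k] {V : Type u} (G : SimpleGraph V) :
    WithBot ℕ∞ :=
  CategoryTheory.projectiveDimension
    (ModuleCat.of (MvPolynomial V k) (MvPolynomial V k ⧸ graphIdeal k G))

/-- `x 0, …, x (n - 1)` list the neighbours of `v` without repetition, all of them except
possibly the last one have degree one, and if there is only one it also has degree one. -/
structure IsPivot {V : Type u} [Fintype V] (G : SimpleGraph V) [DecidableRel G.Adj]
    (v : V) {n : ℕ} (x : Fin n → V) : Prop where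
  injective : Function.Injective x
  range_eq : Set.range x = G.neighborSet v
  degree_eq_one : ∀ i : Fin n, (i : ℕ) + 1 < n → G.degree (x i) = 1
  degree_eq_one_of_unique : n = 1 → ∀ i : Fin n, G.degree (x i) = 1

/-- The neighbours of `v` in the subgraph of `G` induced on the vertices in the list `l`. -/
def nbrs {V : Type u} (G : SimpleGraph V) [DecidableRel G.Adj] (l : List V) (v : V) : List V :=
  l.filter (fun y => G.Adj v y)

/-- Search for a pair `(v, y)` of vertices in `l` such that, in the subgraph of `G` induced on `l`,
`y` is a neighbour of `v` of degree one and all but at most one of the neighbours of `v` have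
degree one. -/
def findPivot {V : Type u} (G : SimpleGraph V) [DecidableRel G.Adj] (l : List V) :
    Option (V × V) :=
  (l.product l).find? fun p =>
    decide (G.Adj p.1 p.2) && decide ((nbrs G l p.2).length = 1) &&
      decide (((nbrs G l p.1).filter fun z => (nbrs G l z).length ≠ 1).length ≤ 1)

theorem mem_of_findPivot {V : Type u} (G : SimpleGraph V) [DecidableRel G.Adj] (l : List V)
    {p : V × V} (h : findPivot G l = some p) : p.1 ∈ l ∧ p.2 ∈ l :=
  List.mem_product.1 (List.mem_of_find?_eq_some h)

theorem length_filter_lt_of_mem {V : Type u} {q : V → Bool} {l : List V} {a : V}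
    (ha : a ∈ l) (hq : ¬ q a = true) : (l.filter q).length < l.length :=
  List.length_filter_lt_length_iff_exists.2 ⟨a, ha, hq⟩

/-- The vertices left in `l` after deleting `y`. -/
def deleteVertex {V : Type u} [DecidableEq V] (l : List V) (y : V) : List V :=
  l.filter fun z => z ≠ y

/-- The vertices left in `l` after deleting `v` and all its neighbours. -/
def deleteClosedNbhd {V : Type u} [DecidableEq V] (G : SimpleGraph V) [DecidableRel G.Adj]
    (l : List V) (v : V) : List V :=
  l.filter fun z => z ≠ v ∧ ¬ G.Adj v z

/-- The recursive algorithm, run on the subgraph of `G` induced on the vertices in the list `l`: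
if no pair `(v, y)` is found, return `0`; otherwise return `max p' (p'' + n)`, where `n` is the
number of neighbours of `v`, and `p'` and `p''` are the results of the algorithm after deleting
`y`, respectively after deleting `v` and all its neighbours. -/
def forestPd {V : Type u} [DecidableEq V] (G : SimpleGraph V) [DecidableRel G.Adj]
    (l : List V) : ℕ :=
  match h : findPivot G l with
  | none => 0
  | some p =>
    max (forestPd G (deleteVertex l p.2))
      (forestPd G (deleteClosedNbhd G l p.1) + (nbrs G l p.1).length)
termination_by l.length
decreasing_by
  · exact length_filter_lt_of_mem (mem_of_findPivot G l h).2 (by simp)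
  · exact length_filter_lt_of_mem (mem_of_findPivot G l h).1 (by simp)

/-! ### Detecting projective dimension through Ext into a restricted class of modules. -/

section ProjectiveDimension

open CategoryTheory CategoryTheory.Abelian CategoryTheory.Limits

universe v₁ u₁ v₂ u₂ w₁ w₂

variable {C : Type u₁} [Category.{v₁} C] [Abelian C] {D : Type u₂} [Category.{v₂} D] [Abelian D]

/-! Let `y` be a leaf attached to `v`, let S be the full polynomial ring and A the one without
`x_y`. With I' the ideal of T \ {y}, multiplication by `x_y x_v` gives 0 → S/J → S/I' → S/I(T) → 0,
where J = (I' : x_y x_v) is generated by the edges of T'' and the neighbours of `v` other than `y`.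
Both I' and J are extended from A, and the first map is `x_y` times a well-defined map. On an
A-module N with `x_y` acting by zero it therefore induces zero on Ext, so the long exact sequence
breaks into short ones. Such N detect the projective dimension of modules extended from A, whence
pd(S/I(T)) = max(pd(S/I'), pd(S/J) + 1). Each of the n - 1 variables in J adds one to the dimension,
which gives the formula (`projectiveDimension_quotient_sup`, `edgeVarPd_leaf`).

Acyclicity enters only through `not_adj_of_findPivot_eq_none`: the search fails only on edgeless
graphs, where the dimension is 0. The algorithm never mentions the field, so independence of the
field follows. -/

/-- An exact functor preserving projective objects does not increase the projective dimension. -/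
theorem hasProjectiveDimensionLT_map [EnoughProjectives C] (E : C ⥤ D) [E.Additive]
    [PreservesFiniteLimits E] [PreservesFiniteColimits E] [E.PreservesProjectiveObjects]
    (M : C) (d : ℕ) (h : HasProjectiveDimensionLT M d) :
    HasProjectiveDimensionLT (E.obj M) d := by
  induction d generalizing M with
  | zero =>
    rw [hasProjectiveDimensionLT_zero_iff_isZero] at h ⊢
    exact E.map_isZero h
  | succ d ih =>
    match d, h, ih with
    | 0, h, _ =>
      rw [zero_add, ← projective_iff_hasProjectiveDimensionLT_one] at h ⊢
      exact Functor.PreservesProjectiveObjects.projective_obj h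
    | d + 1, h, ih =>
      let P : ProjectivePresentation M := Classical.arbitrary _
      let S := ShortComplex.mk _ _ (kernel.condition P.f)
      have hS : S.ShortExact := { exact := ShortComplex.exact_kernel P.f }
      have h2 : Projective S.X₂ := P.projective
      have h2' : Projective (S.map E).X₂ :=
        Functor.PreservesProjectiveObjects.projective_obj P.projective
      have hE : (S.map E).ShortExact := hS.map_of_exact E
      exact (hE.hasProjectiveDimensionLT_X₃_iff d h2').2
        (ih _ ((hS.hasProjectiveDimensionLT_X₃_iff d h2).1 h))

variable [HasExt.{w₂} D]

/-- If `E` has a right adjoint `Q` and `P` is a section of `Q`, the projective dimension of `M` is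
detected by the groups `Ext (E M) (P N) i`. -/
theorem hasProjectiveDimensionLT_of_ext_map_eq_zero [EnoughProjectives C] {E P : C ⥤ D} {Q : D ⥤ C}
    [E.Additive] [PreservesFiniteLimits E] [PreservesFiniteColimits E]
    [E.PreservesProjectiveObjects] [P.Additive] [PreservesFiniteLimits P]
    [PreservesFiniteColimits P] (adj : E ⊣ Q) (iso : P ⋙ Q ≅ 𝟭 C) (M : C) (d : ℕ)
    (h : ∀ (N : C) (i : ℕ), d ≤ i → ∀ e : Ext.{w₂} (E.obj M) (P.obj N) i, e = 0) :
    HasProjectiveDimensionLT M d := by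
  induction d generalizing M with
  | zero =>
    let ev (N : C) (φ : E.obj M ⟶ P.obj N) : M ⟶ N := adj.homEquiv _ _ φ ≫ iso.hom.app N
    let φ : E.obj M ⟶ P.obj M := (adj.homEquiv _ _).symm (iso.inv.app M)
    have hφ : ev M φ = 𝟙 M := by simp [ev, φ]
    rw [hasProjectiveDimensionLT_zero_iff_isZero, IsZero.iff_id_eq_zero, ← hφ]
    have : φ = 0 := Ext.homEquiv₀.symm.injective (by
      rw [h M 0 le_rfl (Ext.homEquiv₀.symm φ), h M 0 le_rfl (Ext.homEquiv₀.symm 0)])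
    have hz : adj.homEquiv M (P.obj M) 0 = 0 := by
      have := E.map_zero M M
      rw [← zero_comp (f := (0 : E.obj M ⟶ P.obj M)) (X := E.obj M), ← this,
        adj.homEquiv_naturality_left]
      simp
    simp [ev, this, hz]
  | succ d ih =>
    let p : ProjectivePresentation M := Classical.arbitrary _
    let S := ShortComplex.mk _ _ (kernel.condition p.f)
    have hS : S.ShortExact := { exact := ShortComplex.exact_kernel p.f }
    match d, h, ih with
    | 0, h, _ =>
      let ev (N : C) (φ : E.obj M ⟶ P.obj N) : M ⟶ N := adj.homEquiv _ _ φ ≫ iso.hom.app N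
      let φ : E.obj M ⟶ P.obj M := (adj.homEquiv _ _).symm (iso.inv.app M)
      have hφ : ev M φ = 𝟙 M := by simp [ev, φ]
      rw [zero_add, ← projective_iff_hasProjectiveDimensionLT_one]
      have hP : (S.map P).ShortExact := hS.map_of_exact P
      -- The transpose `φ` of the identity lifts because Ext¹ into `P` of the kernel vanishes;
      -- transposing the lift back splits `p.f`.
      obtain ⟨ψ, hψ⟩ : ∃ ψ : E.obj M ⟶ P.obj p.p, ψ ≫ P.map p.f = φ := by
        obtain ⟨ψ', hψ⟩ := Ext.covariant_sequence_exact₃ (E.obj M) hP (Ext.mk₀ φ) (zero_add 1)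
          (h _ _ le_rfl _)
        obtain ⟨ψ, rfl⟩ := (Ext.mk₀_bijective _ _).2 ψ'
        rw [Ext.mk₀_comp_mk₀] at hψ
        exact ⟨ψ, (Ext.mk₀_bijective _ _).1 hψ⟩
      have h2 : Projective S.X₂ := p.projective
      refine (Retract.mk (Y := p.p) (ev _ ψ) p.f ?_).projective
      rw [← hφ, ← hψ]
      change (adj.homEquiv M (P.obj p.p) ψ ≫ iso.hom.app p.p) ≫ p.f =
        adj.homEquiv M (P.obj M) (ψ ≫ P.map p.f) ≫ iso.hom.app M
      rw [adj.homEquiv_naturality_right, Category.assoc, Category.assoc]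
      exact congrArg (_ ≫ ·) (iso.hom.naturality p.f).symm
    | d + 1, h, ih =>
      have h2 : Projective S.X₂ := p.projective
      have h2' : Projective (S.map E).X₂ :=
        Functor.PreservesProjectiveObjects.projective_obj p.projective
      have hE : (S.map E).ShortExact := hS.map_of_exact E
      refine (hS.hasProjectiveDimensionLT_X₃_iff d h2).2 (ih _ ?_)
      intro N i hi e
      -- Dimension shifting needs positive degree, so that Ext out of the projective middle term
      -- vanishes; this is why the projective case is treated separately.
      obtain ⟨i, rfl⟩ : ∃ j, i = j + 1 := ⟨i - 1, by omega⟩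
      have h0 : hE.extClass.comp e (add_comm 1 (i + 1)) = 0 := h N _ (by omega) _
      obtain ⟨x, hx⟩ := Ext.contravariant_sequence_exact₁ hE _ e (add_comm 1 (i + 1)) h0
      rw [← hx, x.eq_zero_of_projective, Ext.comp_zero]
      rfl

/-- Since `S.f` kills Ext into `P N`, the long exact sequence splits into 0 → Extⁱ(X₁) → Extⁱ⁺¹(X₃)
→ Extⁱ⁺¹(X₂) → 0. Vanishing for X₃ thus passes to both other terms, and these come from `C`, so
vanishing against the `P N` bounds their dimension. -/
theorem hasProjectiveDimensionLT_X₃_iff_of_precomp_eq_zero [EnoughProjectives C] {E P : C ⥤ D}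
    {Q : D ⥤ C} [E.Additive] [PreservesFiniteLimits E] [PreservesFiniteColimits E]
    [E.PreservesProjectiveObjects] [P.Additive] [PreservesFiniteLimits P]
    [PreservesFiniteColimits P] (adj : E ⊣ Q) (iso : P ⋙ Q ≅ 𝟭 C)
    {S : ShortComplex D} (hS : S.ShortExact) {M₁ M₂ : C} (e₁ : E.obj M₁ ≅ S.X₁)
    (e₂ : E.obj M₂ ≅ S.X₂)
    (h : ∀ (N : C) (i : ℕ) (x : Ext.{w₂} S.X₂ (P.obj N) i),
      (Ext.mk₀ S.f).comp x (zero_add i) = 0) (d : ℕ) :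
    HasProjectiveDimensionLT S.X₃ (d + 1) ↔
      HasProjectiveDimensionLT S.X₂ (d + 1) ∧ HasProjectiveDimensionLT S.X₁ d := by
  refine ⟨fun h₃ => ?_, fun h' => hS.hasProjectiveDimensionLT_X₃ d h'.2 h'.1⟩
  have key {M : C} {X : D} (e : E.obj M ≅ X) (n : ℕ)
      (hX : ∀ (N : C) (i : ℕ), n ≤ i → ∀ x : Ext.{w₂} X (P.obj N) i, x = 0) :
      HasProjectiveDimensionLT X n := by
    have : HasProjectiveDimensionLT M n := by
      refine hasProjectiveDimensionLT_of_ext_map_eq_zero adj iso M n fun N i hi x => ?_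
      rw [← x.mk₀_id_comp, ← e.hom_inv_id, ← Ext.mk₀_comp_mk₀,
        Ext.comp_assoc_of_second_deg_zero,
        hX N i hi ((Ext.mk₀ e.inv).comp x (zero_add i)), Ext.comp_zero]
    have := hasProjectiveDimensionLT_map E M n this
    exact hasProjectiveDimensionLT_of_iso e n
  refine ⟨key e₂ _ fun N i hi x => ?_, key e₁ _ fun N i hi x => ?_⟩
  · obtain ⟨y, rfl⟩ := Ext.contravariant_sequence_exact₂ hS _ x (h N i x)
    rw [y.eq_zero_of_hasProjectiveDimensionLT (d + 1) hi, Ext.comp_zero]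
  · obtain ⟨y, rfl⟩ := Ext.contravariant_sequence_exact₁ hS _ x (add_comm 1 i)
      (Ext.eq_zero_of_hasProjectiveDimensionLT _ (d + 1) (by omega))
    exact h N i y

end ProjectiveDimension

/-! ### Flat ring extensions with a retraction, and the exact sequence of a colon ideal. -/

section ChangeOfRings

open CategoryTheory CategoryTheory.Abelian CategoryTheory.Limits

theorem ENat.WithBot.lt_natCast_iff {x : WithBot ℕ∞} {n : ℕ} : x < n ↔ x + 1 ≤ n := by
  induction x with
  | bot => simp
  | coe x =>
    induction x with
    | top => exact iff_of_false not_top_lt fun h => not_top_lt (h.trans_lt (WithBot.coe_lt_coe.2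
        (ENat.natCast_lt_top n)))
    | coe x => norm_cast

universe u₀

variable {A S : Type u₀} [CommRing A] [CommRing S]

/-- If `g ∘ f = id`, restriction of scalars along `g` is a section of restriction along `f`. -/
noncomputable def restrictScalarsRetractIso {f : A →+* S} {g : S →+* A}
    (h : g.comp f = RingHom.id A) :
    ModuleCat.restrictScalars.{u₀} g ⋙ ModuleCat.restrictScalars.{u₀} f ≅ 𝟭 (ModuleCat.{u₀} A) :=
  (ModuleCat.restrictScalarsComp f g).symm ≪≫ ModuleCat.restrictScalarsId' _ h

/-- The extension of scalars of `A ⧸ I` along `f : A →+* S` is `S ⧸ I S`. -/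
noncomputable def extendScalarsQuotientIso (f : A →+* S) (I : Ideal A) :
    (ModuleCat.extendScalars.{u₀, u₀, u₀} f).obj (ModuleCat.of A (A ⧸ I)) ≅
      ModuleCat.of S (S ⧸ I.map f) :=
  letI := f.toAlgebra
  LinearEquiv.toModuleIso (Algebra.TensorProduct.quotIdealMapEquivTensorQuot S I).symm.toLinearEquiv

instance (f : A →+* S) : (ModuleCat.extendScalars.{u₀, u₀, u₀} f).PreservesProjectiveObjects :=
  Functor.preservesProjectiveObjects_of_adjunction_of_preservesEpimorphisms
    (ModuleCat.extendRestrictScalarsAdj f)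

instance (f : A →+* S) : PreservesFiniteColimits (ModuleCat.extendScalars.{u₀, u₀, u₀} f) :=
  have := (ModuleCat.extendRestrictScalarsAdj.{u₀} f).leftAdjoint_preservesColimits
  inferInstance

variable {f : A →+* S} {g : S →+* A}

/-- By linearity `s` can be moved onto the target, where it acts as `g s = 0`. -/
theorem precomp_smul_eq_zero {s : S} (hs : g s = 0) {X Y : ModuleCat.{u₀} S} (φ : X ⟶ Y)
    (N : ModuleCat.{u₀} A) (i : ℕ) (x : Ext Y ((ModuleCat.restrictScalars.{u₀} g).obj N) i) :
    (Ext.mk₀ (s • φ)).comp x (zero_add i) = 0 := by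
  have h : s • 𝟙 ((ModuleCat.restrictScalars.{u₀} g).obj N) = 0 := by
    ext n
    change g s • (n : N) = 0
    rw [hs, zero_smul]
  rw [Ext.mk₀_smul, Ext.smul_comp, Ext.smul_eq_comp_mk₀, h, Ext.mk₀_zero, Ext.comp_zero]

theorem hasProjectiveDimensionLT_quotient_map_iff (hf : f.Flat) (h : g.comp f = RingHom.id A)
    (I : Ideal A) (d : ℕ) :
    HasProjectiveDimensionLT (ModuleCat.of S (S ⧸ I.map f)) d ↔
      HasProjectiveDimensionLT (ModuleCat.of A (A ⧸ I)) d := by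
  have := ModuleCat.preservesFiniteLimits_extendScalars_of_flat hf
  have : (ModuleCat.extendScalars.{u₀, u₀, u₀} f).Additive :=
    (ModuleCat.extendRestrictScalarsAdj f).left_adjoint_additive
  refine ⟨fun hS => ?_, fun hA => ?_⟩
  · have := hasProjectiveDimensionLT_of_iso (extendScalarsQuotientIso f I).symm d
    exact hasProjectiveDimensionLT_of_ext_map_eq_zero (ModuleCat.extendRestrictScalarsAdj f)
      (restrictScalarsRetractIso h) _ d
      fun N i hi e => e.eq_zero_of_hasProjectiveDimensionLT d hi
  · have := hasProjectiveDimensionLT_map (ModuleCat.extendScalars.{u₀, u₀, u₀} f) _ d hA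
    exact hasProjectiveDimensionLT_of_iso (extendScalarsQuotientIso f I) d

theorem projectiveDimension_quotient_map (hf : f.Flat) (h : g.comp f = RingHom.id A)
    (I : Ideal A) :
    projectiveDimension (ModuleCat.of S (S ⧸ I.map f)) =
      projectiveDimension (ModuleCat.of A (A ⧸ I)) := by
  simp only [projectiveDimension, hasProjectiveDimensionLT_quotient_map_iff hf h]

/-- Multiplication by `s * t` embeds S/JS in S/IS with the third quotient as cokernel. The factor
`t` is kept apart because multiplication by `t` alone is well defined by `ht`; the map is then `s`
times a morphism and vanishes on Ext into restricted modules. -/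
theorem hasProjectiveDimensionLT_quotient_sup_iff (hf : f.Flat) (h : g.comp f = RingHom.id A)
    (I J : Ideal A) {s t : S} (hs : g s = 0) (hJ : ∀ p, s * t * p ∈ I.map f ↔ p ∈ J.map f)
    (ht : ∀ p ∈ J.map f, t * p ∈ I.map f) (d : ℕ) :
    HasProjectiveDimensionLT (ModuleCat.of S (S ⧸ I.map f ⊔ Ideal.span {s * t})) (d + 1) ↔
      HasProjectiveDimensionLT (ModuleCat.of S (S ⧸ I.map f)) (d + 1) ∧
      HasProjectiveDimensionLT (ModuleCat.of S (S ⧸ J.map f)) d := by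
  have := ModuleCat.preservesFiniteLimits_extendScalars_of_flat hf
  have : (ModuleCat.extendScalars.{u₀, u₀, u₀} f).Additive :=
    (ModuleCat.extendRestrictScalarsAdj f).left_adjoint_additive
  let φ : (S ⧸ J.map f) →ₗ[S] (S ⧸ I.map f) := Submodule.mapQ _ _ (LinearMap.mulLeft S t) ht
  let π : (S ⧸ I.map f) →ₗ[S] (S ⧸ I.map f ⊔ Ideal.span {s * t}) :=
    Submodule.mapQ _ _ LinearMap.id le_sup_left
  have hφ (p : S) : (s • φ) (Submodule.Quotient.mk p) = Submodule.Quotient.mk (s * t * p) := by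
    rw [mul_assoc]; rfl
  have hπ (p : S) : π (Submodule.Quotient.mk p) = Submodule.Quotient.mk p := rfl
  have hex : Function.Exact (s • φ) π := by
    intro x
    obtain ⟨p, rfl⟩ := Submodule.Quotient.mk_surjective _ x
    rw [hπ, Submodule.Quotient.mk_eq_zero, Submodule.mem_sup]
    constructor
    · rintro ⟨a, ha, b, hb, rfl⟩
      obtain ⟨c, rfl⟩ := Ideal.mem_span_singleton'.1 hb
      refine ⟨Submodule.Quotient.mk c, ?_⟩
      rw [hφ, Submodule.Quotient.eq, mul_comm, ← neg_mem_iff]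
      simpa using ha
    · rintro ⟨y, hy⟩
      obtain ⟨c, rfl⟩ := Submodule.Quotient.mk_surjective _ y
      rw [hφ, Submodule.Quotient.eq] at hy
      exact ⟨p - s * t * c, by rw [← neg_mem_iff]; simpa using hy, s * t * c,
        Ideal.mem_span_singleton.2 (dvd_mul_right _ _), by ring⟩
  have hinj : Function.Injective (s • φ) := by
    rw [← LinearMap.ker_eq_bot, LinearMap.ker_eq_bot']
    intro x hx
    obtain ⟨p, rfl⟩ := Submodule.Quotient.mk_surjective _ x
    rw [hφ, Submodule.Quotient.mk_eq_zero] at hx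
    rw [Submodule.Quotient.mk_eq_zero]
    exact (hJ p).1 hx
  have hsurj : Function.Surjective π := by
    intro x
    obtain ⟨p, rfl⟩ := Submodule.Quotient.mk_surjective _ x
    exact ⟨Submodule.Quotient.mk p, rfl⟩
  let C : ShortComplex (ModuleCat.{u₀} S) :=
    ShortComplex.mk (ModuleCat.ofHom (s • φ)) (ModuleCat.ofHom π) (by
      exact ModuleCat.hom_ext (LinearMap.ext fun x => (hex _).2 ⟨x, rfl⟩))
  have hC : C.ShortExact := ModuleCat.shortComplex_shortExact C hex hinj hsurj
  exact hasProjectiveDimensionLT_X₃_iff_of_precomp_eq_zero (ModuleCat.extendRestrictScalarsAdj f)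
    (restrictScalarsRetractIso h) hC (extendScalarsQuotientIso f J) (extendScalarsQuotientIso f I)
    (fun N i x => precomp_smul_eq_zero hs (ModuleCat.ofHom φ) N i x) d

theorem projectiveDimension_quotient_sup (hf : f.Flat) (h : g.comp f = RingHom.id A)
    (I J : Ideal A) {s t : S} (hs : g s = 0) (hJ : ∀ p, s * t * p ∈ I.map f ↔ p ∈ J.map f)
    (ht : ∀ p ∈ J.map f, t * p ∈ I.map f) (hne : I.map f ⊔ Ideal.span {s * t} ≠ ⊤) :
    projectiveDimension (ModuleCat.of S (S ⧸ I.map f ⊔ Ideal.span {s * t})) =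
      max (projectiveDimension (ModuleCat.of S (S ⧸ I.map f)))
        (projectiveDimension (ModuleCat.of S (S ⧸ J.map f)) + 1) := by
  have key := hasProjectiveDimensionLT_quotient_sup_iff hf h I J hs hJ ht
  have bot (K : Ideal S) (hK : K ≠ ⊤) :
      ¬ projectiveDimension (ModuleCat.of S (S ⧸ K)) ≤ ⊥ := by
    rw [le_bot_iff, projectiveDimension_eq_bot_iff, ModuleCat.isZero_iff_subsingleton]
    exact not_subsingleton_iff_nontrivial.2 (Ideal.Quotient.nontrivial_iff.2 hK)
  -- The two sides are compared by their upper bounds; properness of the ideals rules out the value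
  -- `⊥` of the zero module.
  refine eq_of_forall_ge_iff fun n => ?_
  induction n with
  | bot =>
    refine iff_of_false (bot _ hne) fun hle => bot (I.map f) ?_ (le_of_max_le_left hle)
    exact fun he => hne (by rw [he, top_sup_eq])
  | coe n =>
    induction n with
    | top => simp
    | coe n =>
      rw [max_le_iff]
      norm_cast
      rw [projectiveDimension_le_iff, projectiveDimension_le_iff, HasProjectiveDimensionLE, key,
        ← projectiveDimension_lt_iff (n := n), ENat.WithBot.lt_natCast_iff]

end ChangeOfRings

/-! ### Ideals generated by edges and variables, and the leaf formula. -/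

section EdgeIdeal

open CategoryTheory MvPolynomial

universe u₁ w₁

variable (k : Type w₁) [Field k] {V : Type u₁}

/-- The larger ring is a polynomial ring, in the variables outside `U`, over the smaller one. -/
theorem flat_rename_val (U : Set V) :
    (rename (Subtype.val : U → V) : MvPolynomial U k →ₐ[k] MvPolynomial V k).toRingHom.Flat := by
  classical
  let e : V ≃ (Uᶜ : Set V) ⊕ U := (Equiv.Set.sumCompl U).symm.trans (Equiv.sumComm _ _)
  let E := (renameEquiv k e).trans (sumAlgEquiv k (Uᶜ : Set V) U)
  have h : (rename (Subtype.val : U → V) : MvPolynomial U k →ₐ[k] MvPolynomial V k).toRingHom =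
      (E.symm : _ →+* MvPolynomial V k).comp
        (algebraMap (MvPolynomial U k) (MvPolynomial (Uᶜ : Set V) (MvPolynomial U k))) := by
    have : E.toRingHom.comp (rename (Subtype.val : U → V)).toRingHom =
        (algebraMap (MvPolynomial U k) (MvPolynomial (Uᶜ : Set V) (MvPolynomial U k))) := by
      refine MvPolynomial.ringHom_ext (fun c => ?_) fun i => ?_
      · simp [E, sumAlgEquiv_C_inl]
      · simp [E, e, sumAlgEquiv_X_inr]
    ext x
    · simp [← this]
    · simp [← this]
  rw [h]
  refine RingHom.Flat.comp ?_ (RingHom.Flat.of_bijective E.symm.bijective)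
  rw [RingHom.flat_algebraMap_iff]
  infer_instance

/-- The ideal generated by the monomials `x_a x_b` for the edges `{a, b}` of `G` contained in `W`
and by the variables `x_z` for `z` in `Z`. -/
noncomputable def edgeVarIdeal (G : SimpleGraph V) (W Z : Set V) : Ideal (MvPolynomial V k) :=
  Ideal.span ({p | ∃ a b : V, G.Adj a b ∧ a ∈ W ∧ b ∈ W ∧ p = X a * X b} ∪ X '' Z)

/-- The support of the monomial `m` contains an edge of `G` inside `W` or a vertex of `Z`. -/
def MeetsEdgeOrVar (G : SimpleGraph V) (W Z : Set V) (m : V →₀ ℕ) : Prop :=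
  (∃ a b, G.Adj a b ∧ a ∈ W ∧ b ∈ W ∧ m a ≠ 0 ∧ m b ≠ 0) ∨ ∃ z ∈ Z, m z ≠ 0

variable {k} {G : SimpleGraph V} {W Z : Set V}

/-- The generators are squarefree monomials, so divisibility by one depends only on which variables
occur. This turns the colon ideal computations into combinatorics. -/
theorem mem_edgeVarIdeal {p : MvPolynomial V k} :
    p ∈ edgeVarIdeal k G W Z ↔ ∀ m ∈ p.support, MeetsEdgeOrVar G W Z m := by
  classical
  have : edgeVarIdeal k G W Z = Ideal.span ((fun s => monomial s (1 : k)) ''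
      ({s | ∃ a b : V, G.Adj a b ∧ a ∈ W ∧ b ∈ W ∧
        s = Finsupp.single a 1 + Finsupp.single b 1} ∪ {s | ∃ z ∈ Z, s = Finsupp.single z 1})) := by
    rw [edgeVarIdeal]
    congr 1
    rw [Set.image_union]
    congr 1
    · ext p
      constructor
      · rintro ⟨a, b, h, ha, hb, rfl⟩
        exact ⟨_, ⟨a, b, h, ha, hb, rfl⟩, by simp [X, monomial_mul]⟩
      · rintro ⟨_, ⟨a, b, h, ha, hb, rfl⟩, rfl⟩
        exact ⟨a, b, h, ha, hb, by simp [X, monomial_mul]⟩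
    · ext p
      constructor
      · rintro ⟨z, hz, rfl⟩
        exact ⟨_, ⟨z, hz, rfl⟩, rfl⟩
      · rintro ⟨_, ⟨z, hz, rfl⟩, rfl⟩
        exact ⟨z, hz, rfl⟩
  rw [this, mem_ideal_span_monomial_image]
  refine forall₂_congr fun m _ => ?_
  constructor
  · rintro ⟨_, ⟨a, b, h, ha, hb, rfl⟩ | ⟨z, hz, rfl⟩, hle⟩
    · refine Or.inl ⟨a, b, h, ha, hb, ?_, ?_⟩
      · have := hle a; simp [h.ne] at this; omega
      · have := hle b; simp [h.ne'] at this; omega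
    · exact Or.inr ⟨z, hz, by have := hle z; simp at this; omega⟩
  · rintro (⟨a, b, h, ha, hb, h1, h2⟩ | ⟨z, hz, h1⟩)
    · refine ⟨_, Or.inl ⟨a, b, h, ha, hb, rfl⟩, fun c => ?_⟩
      have := h.ne
      rw [Finsupp.add_apply, Finsupp.single_apply, Finsupp.single_apply]
      split_ifs <;> subst_vars <;> first | omega | exact absurd rfl this
    · exact ⟨_, Or.inr ⟨z, hz, rfl⟩, by rw [Finsupp.single_le_iff]; omega⟩

theorem X_mul_mem_edgeVarIdeal {p : MvPolynomial V k} {y : V} :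
    X y * p ∈ edgeVarIdeal k G W Z ↔
      ∀ m ∈ p.support, MeetsEdgeOrVar G W Z (Finsupp.single y 1 + m) := by
  simp [mem_edgeVarIdeal, support_X_mul, -mem_support_iff]

theorem X_mul_X_mul_mem_edgeVarIdeal {p : MvPolynomial V k} {y v : V} :
    X y * X v * p ∈ edgeVarIdeal k G W Z ↔ ∀ m ∈ p.support,
      MeetsEdgeOrVar G W Z (Finsupp.single y 1 + (Finsupp.single v 1 + m)) := by
  simp [mul_assoc, mem_edgeVarIdeal, support_X_mul, -mem_support_iff]

theorem edgeVarIdeal_ne_top : edgeVarIdeal k G W Z ≠ ⊤ := by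
  rw [Ne, Ideal.eq_top_iff_one, mem_edgeVarIdeal]
  intro h
  have := h 0 (by simp)
  simp [MeetsEdgeOrVar] at this

theorem map_rename_edgeVarIdeal {U : Set V} (hW : W ⊆ U) (hZ : Z ⊆ U) :
    (edgeVarIdeal k (G.induce U) (Subtype.val ⁻¹' W) (Subtype.val ⁻¹' Z)).map
      (rename (Subtype.val : U → V) : MvPolynomial U k →ₐ[k] MvPolynomial V k).toRingHom =
      edgeVarIdeal k G W Z := by
  rw [edgeVarIdeal, edgeVarIdeal, Ideal.map_span, Set.image_union]
  congr 2
  · ext p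
    constructor
    · rintro ⟨_, ⟨a, b, h, ha, hb, rfl⟩, rfl⟩
      exact ⟨a, b, h, ha, hb, by simp⟩
    · rintro ⟨a, b, h, ha, hb, rfl⟩
      exact ⟨_, ⟨⟨a, hW ha⟩, ⟨b, hW hb⟩, h, ha, hb, rfl⟩, by simp⟩
  · ext p
    constructor
    · rintro ⟨_, ⟨z, hz, rfl⟩, rfl⟩
      exact ⟨z, hz, by simp⟩
    · rintro ⟨z, hz, rfl⟩
      exact ⟨_, ⟨⟨z, hZ hz⟩, hz, rfl⟩, by simp⟩

theorem killCompl_comp_rename_toRingHom (U : Set V) :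
    (killCompl (R := k) (Subtype.val_injective (p := (· ∈ U)))).toRingHom.comp
      (rename (Subtype.val : U → V)).toRingHom = RingHom.id (MvPolynomial U k) :=
  RingHom.ext fun p => killCompl_rename_app _ p

variable (k G W Z) in
/-- The projective dimension of the quotient by `edgeVarIdeal`. -/
noncomputable def edgeVarPd : WithBot ℕ∞ :=
  projectiveDimension (ModuleCat.of (MvPolynomial V k) (MvPolynomial V k ⧸ edgeVarIdeal k G W Z))

/-- Adjoining the unused variables is a flat extension with a retraction. All induced subgraphs can
thus be handled in one ring, with only `W` varying. -/
theorem graphPd_induce : graphPd k (G.induce W) = edgeVarPd k G W ∅ := by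
  rw [edgeVarPd, ← map_rename_edgeVarIdeal subset_rfl (Set.empty_subset _),
    projectiveDimension_quotient_map (flat_rename_val k W) (killCompl_comp_rename_toRingHom W),
    graphPd]
  congr 3 <;> simp [graphIdeal, edgeVarIdeal]

theorem graphPd_eq_edgeVarPd_univ : graphPd k G = edgeVarPd k G Set.univ ∅ := by
  have : graphIdeal k G = edgeVarIdeal k G Set.univ ∅ := by simp [graphIdeal, edgeVarIdeal]
  rw [graphPd, edgeVarPd, this]

theorem edgeVarPd_of_sup {y : V} {W' W'' Z' Z'' : Set V} {t : MvPolynomial V k}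
    (hW' : W' ⊆ {y}ᶜ) (hW'' : W'' ⊆ {y}ᶜ) (hZ' : Z' ⊆ {y}ᶜ) (hZ'' : Z'' ⊆ {y}ᶜ)
    (hsup : edgeVarIdeal k G W Z = edgeVarIdeal k G W' Z' ⊔ Ideal.span {X y * t})
    (hJ : ∀ p, X y * t * p ∈ edgeVarIdeal k G W' Z' ↔ p ∈ edgeVarIdeal k G W'' Z'')
    (ht : ∀ p ∈ edgeVarIdeal k G W'' Z'', t * p ∈ edgeVarIdeal k G W' Z') :
    edgeVarPd k G W Z = max (edgeVarPd k G W' Z') (edgeVarPd k G W'' Z'' + 1) := by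
  have hne := edgeVarIdeal_ne_top (k := k) (G := G) (W := W) (Z := Z)
  rw [edgeVarPd, edgeVarPd, edgeVarPd]
  rw [hsup] at hne ⊢
  rw [← map_rename_edgeVarIdeal hW' hZ'] at hne hJ ht ⊢
  rw [← map_rename_edgeVarIdeal hW'' hZ''] at hJ ht ⊢
  refine projectiveDimension_quotient_sup (flat_rename_val k _)
    (killCompl_comp_rename_toRingHom _) _ _ ?_ hJ ht hne
  change killCompl _ (X y) = 0
  rw [killCompl, aeval_X, dif_neg]
  simp

/-- No generator involves `z`, so `X z` is a nonzerodivisor on the quotient: this is the case `t =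
1` with both ideals equal. -/
theorem edgeVarPd_insert {z : V} (hW : z ∉ W) (hZ : z ∉ Z) :
    edgeVarPd k G W (insert z Z) = edgeVarPd k G W Z + 1 := by
  have hm (m : V →₀ ℕ) : MeetsEdgeOrVar G W Z (Finsupp.single z 1 + m) ↔
      MeetsEdgeOrVar G W Z m := by
    have h (a : V) (ha : a ≠ z) : (Finsupp.single z 1 + m : V →₀ ℕ) a = m a := by
      simp [ha.symm]
    refine or_congr ⟨?_, ?_⟩ ⟨?_, ?_⟩
    · rintro ⟨a, b, hab, ha, hb, h1, h2⟩
      rw [h a fun e => hW (e ▸ ha)] at h1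
      rw [h b fun e => hW (e ▸ hb)] at h2
      exact ⟨a, b, hab, ha, hb, h1, h2⟩
    · rintro ⟨a, b, hab, ha, hb, h1, h2⟩
      exact ⟨a, b, hab, ha, hb, by simp [h1], by simp [h2]⟩
    · rintro ⟨a, ha, h1⟩
      rw [h a fun e => hZ (e ▸ ha)] at h1
      exact ⟨a, ha, h1⟩
    · rintro ⟨a, ha, h1⟩
      exact ⟨a, ha, by simp [h1]⟩
  rw [edgeVarPd_of_sup (y := z) (W' := W) (W'' := W) (Z' := Z) (Z'' := Z) (t := 1)]
  · refine max_eq_right ?_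
    generalize edgeVarPd k G W Z = x
    induction x with
    | bot => simp
    | coe x => exact WithBot.coe_le_coe.2 le_self_add
  · exact fun a ha e => hW (e ▸ ha)
  · exact fun a ha e => hW (e ▸ ha)
  · exact fun a ha e => hZ (e ▸ ha)
  · exact fun a ha e => hZ (e ▸ ha)
  · rw [edgeVarIdeal, edgeVarIdeal, Set.image_insert_eq, Set.union_insert, Ideal.span_insert,
      sup_comm, mul_one]
  · intro p
    rw [mul_one, X_mul_mem_edgeVarIdeal, mem_edgeVarIdeal]
    simp only [hm]
  · simp

theorem edgeVarPd_finset (Z : Finset V) (hZ : Disjoint (Z : Set V) W) :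
    edgeVarPd k G W Z = edgeVarPd k G W ∅ + (Z.card : WithBot ℕ∞) := by
  classical
  induction Z using Finset.induction_on with
  | empty => simp
  | insert z Z hz ih =>
    rw [Finset.coe_insert] at hZ ⊢
    rw [edgeVarPd_insert, ih, Finset.card_insert_of_notMem hz, Nat.cast_succ, add_assoc]
    · exact hZ.mono_left (Set.subset_insert _ _)
    · exact Set.disjoint_left.1 hZ (Set.mem_insert _ _)
    · simpa using hz

/-- The recursive formula for a leaf `y`, in the subgraph induced on `W`, attached to `v`. -/
theorem edgeVarPd_leaf {y v : V} (hy : y ∈ W) (hv : v ∈ W) (hyv : G.Adj y v)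
    (hleaf : ∀ a ∈ W, G.Adj y a → a = v) (N : Finset V) (hN : ∀ a, a ∈ N ↔ a ∈ W ∧ G.Adj v a) :
    edgeVarPd k G W ∅ = max (edgeVarPd k G (W \ {y}) ∅)
      (edgeVarPd k G {a | a ∈ W ∧ a ≠ v ∧ ¬ G.Adj v a} ∅ + (N.card : WithBot ℕ∞)) := by
  classical
  have hyN : y ∈ N := (hN y).2 ⟨hy, hyv.symm⟩
  -- Dividing by `X v` turns the other neighbours of `v` into generators, which makes every edge
  -- meeting them redundant. They contribute `N.card - 1`, and the exact sequence the missing one.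
  rw [edgeVarPd_of_sup (y := y) (W' := W \ {y}) (W'' := {a | a ∈ W ∧ a ≠ v ∧ ¬ G.Adj v a})
    (Z' := ∅) (Z'' := (N.erase y : Finset V)) (t := X v), edgeVarPd_finset, add_assoc,
    ← Nat.cast_one, ← Nat.cast_add, Finset.card_erase_add_one hyN]
  · rw [Set.disjoint_left]
    intro a ha ha'
    exact ha'.2.2 ((hN a).1 (Finset.mem_of_mem_erase ha)).2
  · exact fun a ha => ha.2
  · rintro a ⟨_, _, ha⟩ rfl
    exact ha hyv.symm
  · exact Set.empty_subset _
  · exact fun a ha => Finset.ne_of_mem_erase ha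
  · refine le_antisymm (Ideal.span_le.2 ?_) (sup_le (Ideal.span_mono ?_) (Ideal.span_le.2 ?_))
    · rintro p (⟨a, b, hab, ha, hb, rfl⟩ | ⟨_, ⟨⟩, _⟩)
      by_cases hay : a = y
      · subst hay
        rw [hleaf b hb hab]
        exact Ideal.mem_sup_right (Ideal.mem_span_singleton_self _)
      by_cases hby : b = y
      · subst hby
        rw [hleaf a ha hab.symm, mul_comm]
        exact Ideal.mem_sup_right (Ideal.mem_span_singleton_self _)
      exact Ideal.mem_sup_left (Ideal.subset_span (Or.inl ⟨a, b, hab, ⟨ha, hay⟩, ⟨hb, hby⟩, rfl⟩))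
    · exact Set.union_subset_union_left _ fun p ⟨a, b, hab, ha, hb, h⟩ =>
        ⟨a, b, hab, ha.1, hb.1, h⟩
    · rintro p rfl
      exact Ideal.subset_span (Or.inl ⟨y, v, hyv, hy, hv, rfl⟩)
  · intro p
    rw [X_mul_X_mul_mem_edgeVarIdeal, mem_edgeVarIdeal]
    refine forall₂_congr fun m _ => ⟨?_, ?_⟩
    · rintro (⟨a, b, hab, ⟨ha, hay⟩, ⟨hb, hby⟩, h1, h2⟩ | ⟨_, ⟨⟩, _⟩)
      have hval (c : V) (hc : c ≠ y) (hc' : c ≠ v) :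
          (Finsupp.single y 1 + (Finsupp.single v 1 + m) : V →₀ ℕ) c = m c := by
        simp [hc.symm, hc'.symm]
      have hnb (c : V) (hc : c ∈ W) (hcy : c ≠ y) (hvc : G.Adj v c)
          (h : (Finsupp.single y 1 + (Finsupp.single v 1 + m) : V →₀ ℕ) c ≠ 0) :
          MeetsEdgeOrVar G {a | a ∈ W ∧ a ≠ v ∧ ¬ G.Adj v a} (N.erase y : Finset V) m :=
        Or.inr ⟨c, Finset.mem_erase.2 ⟨hcy, (hN c).2 ⟨hc, hvc⟩⟩, hval c hcy hvc.ne' ▸ h⟩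
      by_cases hva : G.Adj v a
      · exact hnb a ha hay hva h1
      by_cases hvb : G.Adj v b
      · exact hnb b hb hby hvb h2
      have hav : a ≠ v := by rintro rfl; exact hvb hab
      have hbv : b ≠ v := by rintro rfl; exact hva hab.symm
      exact Or.inl ⟨a, b, hab, ⟨ha, hav, hva⟩, ⟨hb, hbv, hvb⟩, hval a hay hav ▸ h1,
        hval b hby hbv ▸ h2⟩
    · rintro (⟨a, b, hab, ⟨ha, hav, hva⟩, ⟨hb, hbv, hvb⟩, h1, h2⟩ | ⟨z, hz, h1⟩)
      · refine Or.inl ⟨a, b, hab, ⟨ha, ?_⟩, ⟨hb, ?_⟩, by simp [h1], by simp [h2]⟩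
        · rintro rfl; exact hva hyv.symm
        · rintro rfl; exact hvb hyv.symm
      · obtain ⟨hzy, hzN⟩ := Finset.mem_erase.1 hz
        obtain ⟨hzW, hvz⟩ := (hN z).1 hzN
        exact Or.inl ⟨v, z, hvz, ⟨hv, hyv.ne'⟩, ⟨hzW, hzy⟩, by simp, by simp [h1]⟩
  · intro p hp
    rw [mem_edgeVarIdeal] at hp
    rw [X_mul_mem_edgeVarIdeal]
    intro m hm
    rcases hp m hm with ⟨a, b, hab, ⟨ha, hav, hva⟩, ⟨hb, hbv, hvb⟩, h1, h2⟩ | ⟨z, hz, h1⟩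
    · refine Or.inl ⟨a, b, hab, ⟨ha, ?_⟩, ⟨hb, ?_⟩, by simp [h1], by simp [h2]⟩
      · rintro rfl; exact hva hyv.symm
      · rintro rfl; exact hvb hyv.symm
    · obtain ⟨hzy, hzN⟩ := Finset.mem_erase.1 hz
      obtain ⟨hzW, hvz⟩ := (hN z).1 hzN
      exact Or.inl ⟨v, z, hvz, ⟨hv, hyv.ne'⟩, ⟨hzW, hzy⟩, by simp, by simp [h1]⟩

end EdgeIdeal

/-! ### Forests: success of the search and correctness of the algorithm. -/

section Forest

variable {V : Type u}

/-- A finite nonempty forest has a vertex with at most one neighbour. -/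
theorem SimpleGraph.IsAcyclic.exists_forall_adj_eq [Finite V] [Nonempty V] {G : SimpleGraph V}
    (h : G.IsAcyclic) : ∃ u, ∀ a b, G.Adj u a → G.Adj u b → a = b := by
  -- At the end `u` of a longest path, a neighbour off the path would lengthen it, and one on the
  -- path beyond the second vertex would close a cycle.
  obtain ⟨u, v, p, hp, hmax⟩ := SimpleGraph.Walk.exists_isPath_forall_isPath_length_le_length G
  have key (w : V) (hadj : G.Adj u w) : w = p.snd := by
    apply h.eq_snd_of_adj_start hp hadj
    by_contra hw
    have := hmax _ _ _ (hp.cons (h := hadj.symm) hw)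
    simp at this
  exact ⟨u, fun a b ha hb => (key a ha).trans (key b hb).symm⟩


variable {G : SimpleGraph V}

theorem edgeVarPd_eq_zero_of_forall_not_adj (k : Type w) [Field k] {W : Set V}
    (h : ∀ a ∈ W, ∀ b ∈ W, ¬ G.Adj a b) : edgeVarPd k G W ∅ = 0 := by
  have h0 : edgeVarIdeal k G W ∅ = ⊥ := by
    rw [edgeVarIdeal, Set.image_empty, Set.union_empty, Ideal.span_eq_bot]
    rintro p ⟨a, b, hab, ha, hb, _⟩
    exact absurd hab (h a ha b hb)
  rw [edgeVarPd, h0]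
  have e : (MvPolynomial V k ⧸ (⊥ : Ideal (MvPolynomial V k))) ≃ₗ[MvPolynomial V k]
    MvPolynomial V k := Submodule.quotEquivOfEqBot _ rfl
  have : Module.Free (MvPolynomial V k) (MvPolynomial V k ⧸ (⊥ : Ideal (MvPolynomial V k))) :=
    Module.Free.of_equiv e.symm
  have : Nontrivial (MvPolynomial V k ⧸ (⊥ : Ideal (MvPolynomial V k))) := e.toEquiv.nontrivial
  exact ModuleCat.projectiveDimension_eq_zero_of_projective _

variable [DecidableRel G.Adj] {l : List V}

theorem mem_nbrs {v a : V} : a ∈ nbrs G l v ↔ a ∈ l ∧ G.Adj v a := by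
  simp [nbrs]

theorem length_nbrs_pos {v a : V} (ha : a ∈ l) (h : G.Adj v a) : 0 < (nbrs G l v).length :=
  List.length_pos_of_mem (mem_nbrs.2 ⟨ha, h⟩)

/-- Consider the forest induced on the set `B` of vertices of degree at least two. If `B` is empty,
any edge is a valid pair. Otherwise some `v` in `B` has at most one neighbour in `B`; having two
neighbours, it also has a leaf, and the two form a valid pair. -/
theorem not_adj_of_findPivot_eq_none (hG : G.IsAcyclic) (hl : l.Nodup)
    (h : findPivot G l = none) {a b : V} (ha : a ∈ l) (hb : b ∈ l) : ¬ G.Adj a b := by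
  intro hab
  have key (v y : V) (hv : v ∈ l) (hy : y ∈ l) (hvy : G.Adj v y)
      (hy1 : (nbrs G l y).length = 1) :
      1 < ((nbrs G l v).filter fun z => (nbrs G l z).length ≠ 1).length := by
    have := List.find?_eq_none.1 h (v, y) (List.mem_product.2 ⟨hv, hy⟩)
    simpa [hvy, hy1] using this
  let B : Set V := {a | a ∈ l ∧ 1 < (nbrs G l a).length}
  have hB {v z : V} (hv : v ∈ l) (hz : z ∈ (nbrs G l v).filter fun z => (nbrs G l z).length ≠ 1) :
      z ∈ B ∧ G.Adj v z := by
    rw [List.mem_filter, mem_nbrs, decide_eq_true_eq] at hz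
    have := length_nbrs_pos hv hz.1.2.symm
    exact ⟨⟨hz.1.1, by omega⟩, hz.1.2⟩
  have hnot {v y : V} (hv : v ∈ l) (hy : y ∈ l) (hvy : G.Adj v y) (hyB : y ∉ B) :
      (nbrs G l y).length = 1 := by
    have := length_nbrs_pos hv hvy.symm
    have : ¬ 1 < (nbrs G l y).length := fun hlt => hyB ⟨hy, hlt⟩
    omega
  rcases B.eq_empty_or_nonempty with hE | hne
  · have := key a b ha hb hab (hnot ha hb hab (hE ▸ Set.notMem_empty b))
    obtain ⟨z, hz⟩ := List.exists_mem_of_length_pos (lt_trans zero_lt_one this)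
    exact hE.subset (hB ha hz).1
  · have hfin : Finite B := (l.finite_toSet.subset fun _ h => h.1).to_subtype
    have : Nonempty B := hne.to_subtype
    obtain ⟨⟨v, hv⟩, huniq⟩ := (hG.induce B).exists_forall_adj_eq
    have hle : ((nbrs G l v).filter fun z => (nbrs G l z).length ≠ 1).length ≤ 1 := by
      have hnd : ((nbrs G l v).filter fun z => (nbrs G l z).length ≠ 1).Nodup :=
        (hl.filter _).filter _
      by_contra! hlt
      refine absurd (hnd.getElem_inj_iff.1 (?_ :
        ((nbrs G l v).filter fun z => (nbrs G l z).length ≠ 1)[0] =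
        ((nbrs G l v).filter fun z => (nbrs G l z).length ≠ 1)[1])) zero_ne_one
      have h0 := hB hv.1 (List.getElem_mem (lt_trans zero_lt_one hlt))
      have h1 := hB hv.1 (List.getElem_mem hlt)
      exact congrArg Subtype.val (huniq ⟨_, h0.1⟩ ⟨_, h1.1⟩ h0.2 h1.2)
    obtain ⟨y, hy, hy1⟩ : ∃ y ∈ nbrs G l v, (nbrs G l y).length = 1 := by
      by_contra! hall
      rw [List.filter_eq_self.2 fun z hz => decide_eq_true (hall z hz)] at hle
      exact absurd hv.2 (not_lt.2 hle)
    rw [mem_nbrs] at hy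
    exact absurd (key v y hv.1 hy.1 hy.2 hy1) (not_lt.2 hle)

theorem edgeVarPd_eq_forestPd [DecidableEq V] (k : Type w) [Field k] (hG : G.IsAcyclic)
    (l : List V) (hl : l.Nodup) : edgeVarPd k G {a | a ∈ l} ∅ = (forestPd G l : WithBot ℕ∞) := by
  induction hn : l.length using Nat.strong_induction_on generalizing l with
  | _ n ih =>
    rw [forestPd]
    split
    next h =>
      rw [edgeVarPd_eq_zero_of_forall_not_adj (W := {a | a ∈ l}) k fun a ha b hb =>
        not_adj_of_findPivot_eq_none hG hl h ha hb]
      rfl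
    next p h =>
      obtain ⟨v, y⟩ := p
      obtain ⟨hv, hy⟩ := mem_of_findPivot G l h
      have hp := List.find?_some h
      simp only [Bool.and_eq_true, decide_eq_true_eq] at hp
      -- The leaf formula needs only that `y` is a leaf; the test on the other neighbours of `v` is
      -- dropped.
      obtain ⟨⟨hvy, hy1⟩, -⟩ := hp
      have hleaf : ∀ a ∈ {a | a ∈ l}, G.Adj y a → a = v := by
        intro a ha hya
        obtain ⟨b, hb⟩ := List.length_eq_one_iff.1 hy1
        have h1 : a ∈ nbrs G l y := mem_nbrs.2 ⟨ha, hya⟩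
        have h2 : v ∈ nbrs G l y := mem_nbrs.2 ⟨hv, hvy.symm⟩
        rw [hb, List.mem_singleton] at h1 h2
        rw [h1, h2]
      rw [edgeVarPd_leaf (y := y) (v := v) hy hv hvy.symm hleaf (nbrs G l v).toFinset
        (fun a => by rw [List.mem_toFinset, mem_nbrs]; rfl),
        List.toFinset_card_of_nodup (show (nbrs G l v).Nodup from hl.filter _)]
      have h1 := ih _ (hn ▸ length_filter_lt_of_mem (q := fun z => decide (z ≠ y)) hy (by simp))
        (deleteVertex l y) (hl.filter _) rfl
      have h2 := ih _ (hn ▸ length_filter_lt_of_mem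
        (q := fun z => decide (z ≠ v ∧ ¬ G.Adj v z)) hv (by simp))
        (deleteClosedNbhd G l v) (hl.filter _) rfl
      have e1 : {a | a ∈ l} \ {y} = {a | a ∈ deleteVertex l y} := by
        ext a; simp [deleteVertex]
      have e2 : {a | a ∈ {a | a ∈ l} ∧ a ≠ v ∧ ¬ G.Adj v a} =
          {a | a ∈ deleteClosedNbhd G l v} := by
        ext a; simp [deleteClosedNbhd]
      rw [e1, e2, h1, h2, ← Nat.cast_add]
      exact (Nat.mono_cast.map_max).symm

theorem graphPd_eq_forestPd [DecidableEq V] (k : Type w) [Field k] (hG : G.IsAcyclic)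
    (hl : l.Nodup) (hmem : ∀ a, a ∈ l) : graphPd k G = (forestPd G l : WithBot ℕ∞) := by
  rw [graphPd_eq_edgeVarPd_univ, ← edgeVarPd_eq_forestPd k hG l hl]
  congr 1
  exact (Set.eq_univ_of_forall hmem).symm

theorem graphPd_eq_max_of_isPivot [Fintype V] (k : Type w) [Field k] {v : V} {n : ℕ} (hn : 0 < n)
    {x : Fin n → V} (hx : IsPivot G v x) :
    graphPd k G =
      max (graphPd k (G.induce ({x ⟨0, hn⟩}ᶜ : Set V)))
        (graphPd k (G.induce ((insert v (Set.range x))ᶜ : Set V)) + (n : WithBot ℕ∞)) := by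
  classical
  have hmem (a : V) : a ∈ Set.range x ↔ G.Adj v a := by rw [hx.range_eq]; rfl
  have hadj : G.Adj v (x ⟨0, hn⟩) := (hmem _).1 ⟨_, rfl⟩
  have hdeg : G.degree (x ⟨0, hn⟩) = 1 := by
    -- For `n = 1` the first neighbour is also the last, which only the separate clause of `IsPivot`
    -- covers.
    by_cases h1 : n = 1
    · exact hx.degree_eq_one_of_unique h1 _
    · exact hx.degree_eq_one _ (by simp; omega)
  obtain ⟨b, _, hb⟩ := (SimpleGraph.degree_eq_one_iff_existsUnique_adj).1 hdeg
  rw [graphPd_eq_edgeVarPd_univ, graphPd_induce, graphPd_induce,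
    edgeVarPd_leaf (y := x ⟨0, hn⟩) (v := v) (Set.mem_univ _) (Set.mem_univ _) hadj.symm
      (fun a _ ha => (hb a ha).trans (hb v hadj.symm).symm) (Finset.univ.image x)
      (fun a => by simpa using hmem a),
    Finset.card_image_of_injective _ hx.injective, Finset.card_univ, Fintype.card_fin]
  congr 3
  · ext a; simp
  · ext a
    rw [Set.mem_compl_iff, Set.mem_insert_iff, hmem]
    simp

end Forest

theorem mainTheorem2 {V : Type u} [Fintype V] [DecidableEq V] (T : SimpleGraph V)
    [DecidableRel T.Adj] (hT : T.IsAcyclic) :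
    -- the projective dimension does not depend on the field
    (∀ (k : Type w) [Field k] (K : Type w') [Field K], graphPd k T = graphPd K T) ∧
    -- the recursive formula, with `T' = T \ {v₁}` and `T'' = T \ {v, v₁, …, vₙ}`
    (∀ (k : Type w) [Field k] (v : V) (n : ℕ) (hn : 0 < n) (x : Fin n → V), IsPivot T v x →
      graphPd k T =
        max (graphPd k (T.induce ({x ⟨0, hn⟩}ᶜ : Set V)))
          (graphPd k (T.induce ((insert v (Set.range x))ᶜ : Set V)) + (n : WithBot ℕ∞))) ∧
    -- the recursive algorithm computes the projective dimension over every field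
    (∀ (k : Type w) [Field k] (l : List V), l.Nodup → (∀ a : V, a ∈ l) →
      graphPd k T = (forestPd T l : WithBot ℕ∞)) := by
  refine ⟨fun k _ K _ => ?_, fun k _ v n hn x hx => graphPd_eq_max_of_isPivot k hn hx,
    fun k _ l hl hmem => graphPd_eq_forestPd k hT hl hmem⟩
  rw [graphPd_eq_forestPd k hT Finset.univ.nodup_toList (by simp),
    graphPd_eq_forestPd K hT Finset.univ.nodup_toList (by simp)]
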